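/- **Setting.** Let $\mathrm{fin}(\mathbb N)$ be the countable set of finite ordered multisets of $\mathbb N$, i.e. finite sequences $s=(s_1,\dots,s_r)$ of elements of $\mathbb N$ with repetitions allowed (possibly directed edges of any finite arity). For an index set $S$, an interaction process is a map $\mathcal I:S\to\mathrm{fin}(\mathbb N)$; its vertices are the elements of $\mathbb N$ that occur in some $\mathcal I(i)$. Two processes $\mathcal I,\mathcal J:S\to\mathrm{fin}(\mathbb N)$ are equivalent if there is a bijection $\rho$ from the vertices of $\mathcal I$ onto the vertices of $\mathcal J$ such that $\mathcal J(i)=\rho(\mathcal I(i))$ (entrywise) for all $i\in S$. The edge-labeled network $\mathcal E_{\mathcal I}$ induced by $\mathcal I$ is its equivalence class, and $\mathfrak E_S$ is the set of all these networks. For $n\ge 1$, $\mathcal E_{\mathcal I}|_{[n]}:=\mathcal E_{\mathcal I|_{[n]}}$ is the restriction to the first $n$ edges, and $\mathfrak E_{\mathbb N}$ carries the $\sigma$-algebra generated by all the maps $\mathcal E\mapsto\mathcal E|_{[n]}$ into the discrete spaces $\mathfrak E_{[n]}$. For a permutation $\sigma$ of $\mathbb N$, $(\mathcal E_{\mathcal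 I})^\sigma:=\mathcal E_{\mathcal I\circ\sigma^{-1}}$. A random network $\mathcal Y\in\mathfrak E_{\mathbb N}$ is *edge exchangeable* if $\mathcal Y^\sigma$ and $\mathcal Y$ have the same law for every permutation $\sigma$ of $\mathbb N$. A network $\mathcal E_{\mathcal I}$ is *blip-free* if no $s\in\mathrm{fin}(\mathbb N)$ satisfies $\mathcal I(i)=s$ for exactly one $i$ (this does not depend on the representative $\mathcal I$). Let $$\mathcal F_1=\Bigl\{(f_s)_{s\in\mathrm{fin}(\mathbb N)}:\ f_s\ge 0,\ \sum_{s}f_s=1\Bigr\},$$ with the $\sigma$-algebra generated by the coordinates. For $f\in\mathcal F_1$ let $\varepsilon_f$ be the law on $\mathfrak E_{\mathbb N}$ of the network $\mathcal E_{\mathcal X}$ induced by $\mathcal X(i)=X_i$, where $X_1,X_2,\dots$ are i.i.d. with $\mathrm{pr}(X_i=s)=f_s$. **Theorem 4.2.** Let $\mathcal Y$ be a random element of $\mathfrak E_{\mathbb N}$ that is edge exchangeable and blip-free with probability $1$. Then there exists a probability measure $\phi$ on $\mathcal F_1$ such that $\mathcal Y\sim\varepsilon_\phi$, where $$\varepsilon_\phi(\cdot)=\int_{\mathcal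 F_1}\varepsilon_f(\cdot)\,\phi(df).$$ -/

import Mathlib

open MeasureTheory ProbabilityTheory

namespace EdgeExch

/-- `fin(ℕ)`: the finite ordered multisets of vertex labels, i.e. finite sequences
`(s₁, …, s_r)` of labels, repetitions allowed (a directed edge of arity `r`). -/
abbrev Interaction : Type := List ℕ

/-- The countable set `fin(ℕ)` carries the discrete σ-algebra. -/
instance : MeasurableSpace Interaction := ⊤

instance : DiscreteMeasurableSpace Interaction := ⟨fun _ => trivial⟩

/-- An interaction process `𝓘 : S → fin(ℕ)`. -/
abbrev InteractionProcess (S : Type*) : Type _ := S → Interaction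

variable {S T : Type*}

/-- The population members that take part in at least one interaction. -/
def participants (I : InteractionProcess S) : Set ℕ := {v | ∃ i, v ∈ I i}

/-- `J = ρ I` for a bijection `ρ` from the participants of `I` onto those of `J`. -/
def Equivalent (I J : InteractionProcess S) : Prop :=
  ∃ ρ : ℕ → ℕ, Set.BijOn ρ (participants I) (participants J) ∧ ∀ i, J i = (I i).map ρ

theorem Equivalent.refl (I : InteractionProcess S) : Equivalent I I :=
  ⟨id, Set.bijOn_id _, fun i => by simp⟩

theorem Equivalent.symm {I J : InteractionProcess S} (h : Equivalent I J) : Equivalent J I := by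
  obtain ⟨ρ, hρ, h⟩ := h
  have hinv := hρ.invOn_invFunOn
  refine ⟨Function.invFunOn ρ (participants I), hρ.symm hinv.symm, fun i => ?_⟩
  rw [h i, List.map_map]
  conv_lhs => rw [← List.map_id (I i)]
  exact List.map_congr_left fun v hv => (hinv.1 ⟨i, hv⟩).symm

theorem Equivalent.trans {I J K : InteractionProcess S} (h : Equivalent I J)
    (h' : Equivalent J K) : Equivalent I K := by
  obtain ⟨ρ, hρ, h⟩ := h
  obtain ⟨τ, hτ, h'⟩ := h'
  exact ⟨τ ∘ ρ, hτ.comp hρ, fun i => by rw [h' i, h i, List.map_map]⟩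

instance processSetoid (S : Type*) : Setoid (InteractionProcess S) :=
  ⟨Equivalent, Equivalent.refl, Equivalent.symm, Equivalent.trans⟩

/-- `𝔈_S`: networks with edges labeled by `S`, that is, interaction processes on `S` up to
bijective relabeling of the vertices. -/
def EdgeNetwork (S : Type*) : Type _ := Quotient (processSetoid S)

/-- The edge-labeled network induced by an interaction process. -/
def network (I : InteractionProcess S) : EdgeNetwork S := Quotient.mk (processSetoid S) I

theorem Equivalent.comp {I J : InteractionProcess S} (h : Equivalent I J) (g : T → S) :
    Equivalent (I ∘ g) (J ∘ g) := by
  obtain ⟨ρ, hρ, h⟩ := h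
  refine ⟨ρ, ⟨?_, ?_, ?_⟩, fun i => h (g i)⟩
  · rintro v ⟨i, hv⟩
    exact ⟨i, by simpa [h] using ⟨v, hv, rfl⟩⟩
  · refine hρ.injOn.mono ?_
    rintro v ⟨i, hv⟩
    exact ⟨g i, hv⟩
  · rintro w ⟨i, hw⟩
    obtain ⟨v, hv, rfl⟩ := List.mem_map.1 (show w ∈ (I (g i)).map ρ from h (g i) ▸ hw)
    exact ⟨v, ⟨i, hv⟩, rfl⟩

/-- A blip of a process is an interaction that occurs exactly once. -/
def IsBlip (I : InteractionProcess S) (s : Interaction) : Prop := ∃! i, I i = s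

namespace EdgeNetwork

/-- Pull back the edge labels along `g : T → S`: the edge labeled `t` in the new network is the
edge labeled `g t` in the old one. -/
def reindex (g : T → S) : EdgeNetwork S → EdgeNetwork T :=
  Quotient.map (fun I => I ∘ g) fun _ _ h => Equivalent.comp h g

/-- The restriction of a network to its first `n` edges. -/
def restrict (n : ℕ) : EdgeNetwork ℕ → EdgeNetwork (Fin n) := reindex Fin.val

/-- `𝓔^σ`, induced by the process `I^σ(i) = I(σ⁻¹(i))`. -/
def relabel (σ : Equiv.Perm S) : EdgeNetwork S → EdgeNetwork S := reindex ⇑(σ⁻¹)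

/-- The σ-algebra on `𝔈_ℕ` generated by the restrictions to finitely many edges, i.e. the Borel
σ-algebra of the metric `1 / (1 + sup {n | 𝓔|[n] = 𝓔'|[n]})`. -/
instance : MeasurableSpace (EdgeNetwork ℕ) :=
  ⨆ n : ℕ, MeasurableSpace.comap (restrict n) ⊤

/-- A network is blip-free if the processes inducing it have no blips. -/
def BlipFree : EdgeNetwork S → Prop :=
  Quotient.lift (fun I => ∀ s, ¬ IsBlip I s) <| by
    have key : ∀ I J : InteractionProcess S, Equivalent I J →
        (∀ s, ¬ IsBlip I s) → ∀ s, ¬ IsBlip J s := by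
      rintro I J ⟨ρ, -, h⟩ hI s ⟨i, hi, huniq⟩
      refine hI (I i) ⟨i, rfl, fun j hj => huniq j ?_⟩
      change J j = s
      rw [← hi, h i, h j]
      exact congrArg _ hj
    exact fun I J h => propext ⟨key I J h, key J I (Equivalent.symm h)⟩

end EdgeNetwork

theorem measurable_network : Measurable (network : InteractionProcess ℕ → EdgeNetwork ℕ) := by
  refine measurable_iff_comap_le.2 ?_
  simp only [EdgeNetwork.instMeasurableSpaceNat, MeasurableSpace.comap_iSup,
    MeasurableSpace.comap_comp]
  refine iSup_le fun n => ?_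
  have h : EdgeNetwork.restrict n ∘ network
      = (network : InteractionProcess (Fin n) → _) ∘ fun I i => I i.val := rfl
  rw [h, ← MeasurableSpace.comap_comp]
  refine (MeasurableSpace.comap_mono le_top).trans (Measurable.comap_le (m₂ := ⊤) ?_)
  have : @Measurable _ _ MeasurableSpace.pi MeasurableSpace.pi
      (fun (I : InteractionProcess ℕ) (i : Fin n) => I i.val) := by fun_prop
  intro s _
  exact this (Set.to_countable s).measurableSet

theorem EdgeNetwork.measurable_relabel (σ : Equiv.Perm ℕ) :
    Measurable (EdgeNetwork.relabel σ) := by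
  refine measurable_iff_comap_le.2 ?_
  simp only [EdgeNetwork.instMeasurableSpaceNat, MeasurableSpace.comap_iSup,
    MeasurableSpace.comap_comp]
  refine iSup_le fun n => ?_
  obtain ⟨m, hm⟩ : ∃ m : ℕ, ∀ i : Fin n, σ⁻¹ i.val < m :=
    ⟨(Finset.univ.sup fun i : Fin n => σ⁻¹ i.val) + 1, fun i =>
      Nat.lt_succ_of_le (Finset.le_sup (f := fun i : Fin n => σ⁻¹ i.val) (Finset.mem_univ i))⟩
  have h : EdgeNetwork.restrict n ∘ EdgeNetwork.relabel σ
      = EdgeNetwork.reindex (fun i : Fin n => (⟨σ⁻¹ i.val, hm i⟩ : Fin m))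
        ∘ EdgeNetwork.restrict m := by
    funext E
    induction E using Quotient.inductionOn with
    | h I => rfl
  rw [h, ← MeasurableSpace.comap_comp]
  exact (MeasurableSpace.comap_mono le_top).trans
    (le_iSup (fun n => MeasurableSpace.comap (EdgeNetwork.restrict n) ⊤) m)

/-- A random network is edge exchangeable if its law is invariant under every permutation of the
edge labels. -/
def EdgeExchangeable {Ω : Type*} [MeasurableSpace Ω] (P : Measure Ω) (Y : Ω → EdgeNetwork ℕ) :
    Prop :=
  ∀ σ : Equiv.Perm ℕ, IdentDistrib (fun ω => (Y ω).relabel σ) Y P P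

/-- The `fin(ℕ)`-simplex `𝓕₁`. -/
def Simplex : Type := {f : Interaction → ℝ // (∀ s, 0 ≤ f s) ∧ HasSum f 1}

/-- The σ-algebra on `𝓕₁` generated by the coordinates `f ↦ f_s`. -/
instance : MeasurableSpace Simplex := Subtype.instMeasurableSpace

namespace Simplex

/-- The distribution `pr(X = s) = f_s` on `fin(ℕ)`. -/
noncomputable def toPMF (f : Simplex) : PMF Interaction :=
  ⟨fun s => ENNReal.ofReal (f.1 s), by
    have h := ENNReal.ofReal_tsum_of_nonneg f.2.1 f.2.2.summable
    rw [f.2.2.tsum_eq, ENNReal.ofReal_one] at h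
    exact h ▸ ENNReal.summable.hasSum⟩

/-- The law of i.i.d. interactions `X₁, X₂, …` with distribution `f`. -/
noncomputable def iidLaw (f : Simplex) : Measure (InteractionProcess ℕ) :=
  Measure.infinitePi fun _ : ℕ => f.toPMF.toMeasure

/-- `ε_f`: the law of the network induced by i.i.d. interactions with distribution `f`. -/
noncomputable def networkLaw (f : Simplex) : Measure (EdgeNetwork ℕ) :=
  f.iidLaw.map network

theorem measurable_toMeasure_apply (A : Set Interaction) :
    Measurable fun f : Simplex => f.toPMF.toMeasure A := by
  have h : ∀ f : Simplex, f.toPMF.toMeasure A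
      = ∑' s, A.indicator (fun s => ENNReal.ofReal (f.1 s)) s :=
    fun f => PMF.toMeasure_apply _ MeasurableSet.of_discrete
  simp only [h]
  refine Measurable.tsum fun s => ?_
  by_cases hs : s ∈ A
  · simp only [Set.indicator_of_mem hs]
    exact ((measurable_pi_apply s).comp measurable_subtype_coe).ennreal_ofReal
  · simp [Set.indicator_of_notMem hs]

theorem measurable_iidLaw : Measurable iidLaw := by
  have : ∀ f, IsProbabilityMeasure (iidLaw f) := fun f => by unfold iidLaw; infer_instance
  refine Measurable.measure_of_isPiSystem_of_isProbabilityMeasure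
    (generateFrom_squareCylinders (α := fun _ : ℕ => Interaction)).symm
    (isPiSystem_squareCylinders (fun _ => MeasurableSpace.isPiSystem_measurableSet)
      (fun _ => Set.mem_ofPred.2 MeasurableSet.univ)) ?_
  rintro _ ⟨s, t, -, rfl⟩
  have h : ∀ f, iidLaw f ((s : Set ℕ).pi t) = ∏ i ∈ s, f.toPMF.toMeasure (t i) :=
    fun f => Measure.infinitePi_pi _ fun _ _ => MeasurableSet.of_discrete
  simp only [h]
  exact Finset.measurable_prod _ fun i _ => measurable_toMeasure_apply _

theorem measurable_networkLaw : Measurable networkLaw :=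
  (Measure.measurable_map _ measurable_network).comp measurable_iidLaw

end Simplex

/-- `ε_φ(·) = ∫ ε_f(·) φ(df)`. -/
noncomputable def mixtureLaw (φ : Measure Simplex) : Measure (EdgeNetwork ℕ) :=
  φ.bind Simplex.networkLaw

theorem mixtureLaw_apply (φ : Measure Simplex) {A : Set (EdgeNetwork ℕ)} (hA : MeasurableSet A) :
    mixtureLaw φ A = ∫⁻ f, f.networkLaw A ∂φ :=
  Measure.bind_apply hA Simplex.measurable_networkLaw.aemeasurable

end EdgeExch

/-!
Naming each vertex after its first occurrence gives every network a canonical representative whose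
`i`-th interaction depends only on the first `i + 1` edges, so that single edges become random
variables.

For a fixed `i`, edge exchangeability makes the events that edge `j` equals edge `i`, for `j > i`,
equally likely with equally likely pairwise intersections. Their indicators are vectors of a Hilbert
space with constant mutual inner products, so averages along powers of four converge almost surely,
and every interaction of the canonical representative has an asymptotic frequency. The probability
that an edge beyond the first `m` repeats one of those equals the probability that edge `0` recurs
among the `m` edges that follow it. This tends to one for a blip-free network, hence no mass is lost
and the frequencies sum to one.

Drawing `n` of the first `N` edges without replacement reproduces the law of the restriction to
`[n]`, and drawing them with replacement differs only on collisions, whose probability vanishes as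
`N → ∞`. By Fatou's lemma the mixture of the `ε_f` over the random frequencies is at most the law of
the network on every event about finitely many edges. Both are probability measures, so they agree.
-/

namespace EdgeExch

open Filter Topology
open scoped ENNReal InnerProductSpace

section Canonical

theorem idxOf_map {α β : Type*} [DecidableEq α] [DecidableEq β] {f : α → β} {a : α} {l : List α}
    (h : ∀ b ∈ l, f b = f a → b = a) : (l.map f).idxOf (f a) = l.idxOf a := by
  induction l with
  | nil => rfl
  | cons b l ih =>
    rw [List.forall_mem_cons] at h
    have hb : f b = f a ↔ b = a := ⟨h.1, congrArg f⟩
    simp only [List.map_cons, List.idxOf_cons, ih h.2, beq_eq_decide, hb]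

variable {I J : InteractionProcess ℕ} {v : ℕ}

/-- The label of the first edge containing the vertex `v`. -/
noncomputable def firstEdge (I : InteractionProcess ℕ) (v : ℕ) : ℕ := sInf {i | v ∈ I i}

/-- The first occurrence of the vertex `v`: the pair of its first edge and its position in it. -/
noncomputable def birth (I : InteractionProcess ℕ) (v : ℕ) : ℕ :=
  Nat.pair (firstEdge I v) ((I (firstEdge I v)).idxOf v)

/-- The canonical process inducing the same network as `I`: every vertex is named after its first
occurrence. -/
noncomputable def canonical (I : InteractionProcess ℕ) : InteractionProcess ℕ :=
  fun i => (I i).map (birth I)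

theorem mem_firstEdge (hv : v ∈ participants I) : v ∈ I (firstEdge I v) :=
  Nat.sInf_mem (s := {i | v ∈ I i}) hv

theorem firstEdge_le {i : ℕ} (hv : v ∈ I i) : firstEdge I v ≤ i := Nat.sInf_le hv

theorem injOn_birth (I : InteractionProcess ℕ) : Set.InjOn (birth I) (participants I) := by
  intro v hv w _ h
  obtain ⟨hedge, hidx⟩ := Nat.pair_eq_pair.1 h
  rw [← hedge] at hidx
  exact (List.idxOf_inj (mem_firstEdge hv)).1 hidx

theorem participants_canonical (I : InteractionProcess ℕ) :
    participants (canonical I) = birth I '' participants I := by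
  ext w
  simp only [participants, canonical, List.mem_map, Set.mem_ofPred_eq, Set.mem_image]
  exact ⟨fun ⟨i, v, hv, hw⟩ => ⟨v, ⟨i, hv⟩, hw⟩, fun ⟨v, ⟨i, hv⟩, hw⟩ => ⟨i, v, hv, hw⟩⟩

theorem network_canonical (I : InteractionProcess ℕ) : network (canonical I) = network I := by
  have hbij : Set.BijOn (birth I) (participants I) (participants (canonical I)) :=
    participants_canonical I ▸ (injOn_birth I).bijOn_image
  exact (Quotient.sound (s := processSetoid ℕ) ⟨birth I, hbij, fun _ => rfl⟩).symm

section Restrict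

variable {n i : ℕ} {τ : ℕ → ℕ}

theorem apply_mem_iff (hJ : ∀ k : Fin n, J k = (I k).map τ)
    (hτ : Set.InjOn τ (participants fun k : Fin n => I k)) (hi : i < n) (hv : v ∈ I i) {k : ℕ}
    (hk : k < n) : τ v ∈ J k ↔ v ∈ I k := by
  rw [hJ ⟨k, hk⟩, List.mem_map]
  exact ⟨fun ⟨w, hw, e⟩ => hτ ⟨⟨k, hk⟩, hw⟩ ⟨⟨i, hi⟩, hv⟩ e ▸ hw, fun h => ⟨v, h, rfl⟩⟩

theorem firstEdge_apply (hJ : ∀ k : Fin n, J k = (I k).map τ)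
    (hτ : Set.InjOn τ (participants fun k : Fin n => I k)) (hi : i < n) (hv : v ∈ I i) :
    firstEdge J (τ v) = firstEdge I v := by
  have hmem {k : ℕ} (hk : k < n) := apply_mem_iff hJ hτ hi hv hk
  have hvJ : τ v ∈ J i := (hmem hi).2 hv
  exact le_antisymm
    (firstEdge_le ((hmem ((firstEdge_le hv).trans_lt hi)).2 (mem_firstEdge ⟨i, hv⟩)))
    (firstEdge_le ((hmem ((firstEdge_le hvJ).trans_lt hi)).1 (mem_firstEdge ⟨i, hvJ⟩)))

theorem birth_apply (hJ : ∀ k : Fin n, J k = (I k).map τ)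
    (hτ : Set.InjOn τ (participants fun k : Fin n => I k)) (hi : i < n) (hv : v ∈ I i) :
    birth J (τ v) = birth I v := by
  have hfirst : firstEdge I v < n := (firstEdge_le hv).trans_lt hi
  rw [birth, birth, firstEdge_apply hJ hτ hi hv, hJ ⟨firstEdge I v, hfirst⟩, idxOf_map]
  exact fun w hw e => hτ ⟨⟨_, hfirst⟩, hw⟩ ⟨⟨i, hi⟩, hv⟩ e

theorem canonical_eq_of_restrict (hi : i < n)
    (h : Equivalent (fun k : Fin n => I k) fun k : Fin n => J k) :
    canonical I i = canonical J i := by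
  obtain ⟨τ, hτ, hJ⟩ := h
  have hJi : J i = (I i).map τ := hJ ⟨i, hi⟩
  rw [canonical, canonical, hJi, List.map_map]
  exact List.map_congr_left fun v hv => (birth_apply hJ hτ.injOn hi hv).symm

end Restrict

end Canonical

namespace EdgeNetwork

variable {S T U : Type*}

/-- The canonical representative of a network. It makes single edges random variables, since its
`i`-th interaction depends only on the first `i + 1` edges of the network. -/
noncomputable def rep : EdgeNetwork ℕ → InteractionProcess ℕ :=
  Quotient.lift canonical fun _ _ h =>
    funext fun i => canonical_eq_of_restrict i.lt_succ_self (h.comp Fin.val)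

theorem network_rep (E : EdgeNetwork ℕ) : network E.rep = E :=
  Quotient.inductionOn E network_canonical

theorem rep_eq_of_restrict_eq {E F : EdgeNetwork ℕ} {n i : ℕ} (hi : i < n)
    (h : E.restrict n = F.restrict n) : E.rep i = F.rep i := by
  induction E, F using Quotient.inductionOn₂ with
  | h I J => exact canonical_eq_of_restrict hi (Quotient.exact h)

theorem reindex_eq_network (g : T → ℕ) (E : EdgeNetwork ℕ) : E.reindex g = network (E.rep ∘ g) := by
  conv_lhs => rw [← network_rep E]
  rfl

theorem reindex_reindex (g : T → S) (h : U → T) (E : EdgeNetwork S) :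
    (E.reindex g).reindex h = E.reindex (g ∘ h) :=
  Quotient.inductionOn E fun _ => rfl

/-- The edges labeled `i` and `j` are the same interaction, in one and hence in every process
inducing the network. -/
def SameEdge (E : EdgeNetwork S) (i j : S) : Prop :=
  Quotient.liftOn E (fun I => I i = I j) <| by
    have key : ∀ I J : InteractionProcess S, Equivalent I J → I i = I j → J i = J j := by
      rintro I J ⟨ρ, -, h⟩ e
      rw [h i, h j, e]
    exact fun I J h => propext ⟨key I J h, key J I h.symm⟩

theorem sameEdge_reindex (g : T → S) (E : EdgeNetwork S) (i j : T) :
    (E.reindex g).SameEdge i j ↔ E.SameEdge (g i) (g j) :=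
  Quotient.inductionOn E fun _ => Iff.rfl

theorem sameEdge_iff_rep {E : EdgeNetwork ℕ} {i j : ℕ} : E.SameEdge i j ↔ E.rep i = E.rep j := by
  conv_lhs => rw [← network_rep E]
  rfl

theorem blipFree_iff {E : EdgeNetwork S} : E.BlipFree ↔ ∀ i, ∃ j, j ≠ i ∧ E.SameEdge j i := by
  induction E using Quotient.inductionOn with
  | h I =>
  change (∀ s, ¬ ∃! i, I i = s) ↔ ∀ i, ∃ j, j ≠ i ∧ I j = I i
  constructor
  · intro h i
    by_contra! hi
    exact h _ ⟨i, rfl, fun j e => by_contra fun hji => hi j hji e⟩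
  · rintro h s ⟨i, rfl, hi⟩
    obtain ⟨j, hj, e⟩ := h i
    exact hj (hi j e)

section Measurability

theorem measurableSet_preimage_restrict (n : ℕ) (A : Set (EdgeNetwork (Fin n))) :
    MeasurableSet (restrict n ⁻¹' A) :=
  le_iSup (fun n => MeasurableSpace.comap (restrict n) ⊤) n _ ⟨A, trivial, rfl⟩

theorem measurableSet_preimage_reindex [Finite T] (g : T → ℕ) (A : Set (EdgeNetwork T)) :
    MeasurableSet (reindex g ⁻¹' A) := by
  obtain ⟨m, hm⟩ := (Set.finite_range g).bddAbove
  let h : T → Fin (m + 1) := fun t => ⟨g t, Nat.lt_succ_of_le (hm ⟨t, rfl⟩)⟩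
  have hg : reindex g = reindex h ∘ restrict (m + 1) :=
    funext fun E => (reindex_reindex Fin.val h E).symm
  rw [hg, Set.preimage_comp]
  exact measurableSet_preimage_restrict _ _

theorem measurable_rep (i : ℕ) : Measurable fun E : EdgeNetwork ℕ => E.rep i := by
  intro s _
  convert measurableSet_preimage_restrict (i + 1) (restrict (i + 1) '' {E | E.rep i ∈ s}) using 1
  refine (Set.subset_preimage_image _ _).antisymm ?_
  rintro E ⟨F, hF, h⟩
  change E.rep i ∈ s
  rwa [← rep_eq_of_restrict_eq i.lt_succ_self h]

theorem measurableSet_sameEdge (i j : ℕ) : MeasurableSet {E : EdgeNetwork ℕ | E.SameEdge i j} := by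
  simp only [sameEdge_iff_rep]
  exact measurableSet_eq_fun (measurable_rep i) (measurable_rep j)

theorem measurableSet_blipFree : MeasurableSet {E : EdgeNetwork ℕ | E.BlipFree} := by
  simp only [blipFree_iff]
  exact measurableSet_setOfPred.2 <| .forall fun i => .exists fun j =>
    measurable_const.and (measurableSet_setOfPred.1 (measurableSet_sameEdge j i))

end Measurability

section Exchangeable

/-- The laws of the edge exchangeable random networks: the measures on `𝔈_ℕ` that every relabeling
of the edges preserves. -/
def ExchangeableLaw (μ : Measure (EdgeNetwork ℕ)) : Prop :=
  ∀ σ : Equiv.Perm ℕ, MeasurePreserving (relabel σ) μ μ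

theorem exchangeableLaw_map {Ω : Type*} [MeasurableSpace Ω] {P : Measure Ω} {Y : Ω → EdgeNetwork ℕ}
    (hY : Measurable Y) (h : EdgeExchangeable P Y) : ExchangeableLaw (P.map Y) := fun σ =>
  ⟨measurable_relabel σ, by
    rw [Measure.map_map (measurable_relabel σ) hY]
    exact (h σ).map_eq⟩

theorem exists_perm_comp_eq {α : Type*} {n : ℕ} {x y : Fin n → α} (hx : Function.Injective x)
    (hy : Function.Injective y) : ∃ σ : Equiv.Perm α, σ ∘ x = y := by
  have := Equiv.Perm.isMultiplyPretransitive α n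
  obtain ⟨σ, h⟩ := MulAction.exists_smul_eq (Equiv.Perm α) (⟨x, hx⟩ : Fin n ↪ α) ⟨y, hy⟩
  exact ⟨σ, congrArg DFunLike.coe h⟩

variable {μ : Measure (EdgeNetwork ℕ)} {n : ℕ} {g : Fin n → ℕ}

theorem ExchangeableLaw.measure_preimage_reindex (hμ : ExchangeableLaw μ)
    (hg : Function.Injective g) (A : Set (EdgeNetwork (Fin n))) :
    μ (reindex g ⁻¹' A) = μ (restrict n ⁻¹' A) := by
  obtain ⟨τ, rfl⟩ := exists_perm_comp_eq Fin.val_injective hg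
  have hcomp : reindex (τ ∘ Fin.val) = restrict n ∘ relabel τ⁻¹ :=
    funext fun E => (reindex_reindex _ _ E).symm
  rw [hcomp, Set.preimage_comp,
    (hμ τ⁻¹).measure_preimage (measurableSet_preimage_restrict n A).nullMeasurableSet]

end Exchangeable

end EdgeNetwork

/-- The Cesàro mean `(z 0 + ⋯ + z (N - 1)) / N`. -/
noncomputable def cesaroMean {E : Type*} [AddCommGroup E] [Module ℝ E] (z : ℕ → E) (N : ℕ) : E :=
  (N : ℝ)⁻¹ • ∑ j ∈ Finset.range N, z j

theorem tendsto_cesaroMean_of_shift {E : Type*} [NormedAddCommGroup E] [NormedSpace ℝ E]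
    {z : ℕ → E} {C : ℝ} (hz : ∀ j, ‖z j‖ ≤ C) {ι : Type*} {l : Filter ι} {u : ι → ℕ}
    (hu : Tendsto u l atTop) {x : E} :
    ∀ {c : ℕ}, Tendsto (fun k => cesaroMean (fun j => z (j + c)) (u k)) l (𝓝 x) →
      Tendsto (fun k => cesaroMean z (u k)) l (𝓝 x)
  | 0, h => h
  | c + 1, h => by
    refine tendsto_cesaroMean_of_shift hz hu (c := c) ?_
    have hdiff : Tendsto (fun N : ℕ => (N : ℝ)⁻¹ • (z (N + c) - z (0 + c))) atTop (𝓝 0) := by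
      refine tendsto_inv_atTop_nhds_zero_nat.zero_smul_isBoundedUnder_le ?_
      exact isBoundedUnder_of ⟨C + C, fun N => norm_sub_le_of_le (hz _) (hz _)⟩
    convert h.sub (hdiff.comp hu) using 2 with k
    · simp only [cesaroMean, Function.comp_apply, ← smul_sub,
        ← Finset.sum_range_sub (fun j => z (j + c)), ← Finset.sum_sub_distrib]
      simp [add_right_comm, add_assoc]
    · rw [sub_zero]

section InnerProductSpace

variable {H : Type*} [NormedAddCommGroup H] [InnerProductSpace ℝ H] {z : ℕ → H} {a b : ℝ}

theorem inner_cesaroMean (ha : ∀ j, ⟪z j, z j⟫_ℝ = a) (hb : ∀ j k, j ≠ k → ⟪z j, z k⟫_ℝ = b)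
    {N M : ℕ} (hN : N ≠ 0) (hNM : N ≤ M) :
    ⟪cesaroMean z N, cesaroMean z M⟫_ℝ = (a - b) / M + b := by
  have hM : M ≠ 0 := by omega
  have hinner : ∀ j k, ⟪z j, z k⟫_ℝ = (if j = k then a - b else 0) + b := by
    intro j k
    split_ifs with hjk
    · rw [hjk, ha]
      ring
    · rw [hb j k hjk, zero_add]
  have hrow : ∀ j ∈ Finset.range N, ∑ k ∈ Finset.range M, ⟪z j, z k⟫_ℝ = a - b + M * b := by
    intro j hj
    simp [hinner, Finset.sum_add_distrib, (Finset.mem_range.1 hj).trans_le hNM]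
  rw [cesaroMean, cesaroMean, real_inner_smul_left, real_inner_smul_right, sum_inner]
  simp only [inner_sum]
  rw [Finset.sum_congr rfl hrow]
  simp only [Finset.sum_const, Finset.card_range, nsmul_eq_mul]
  field_simp

theorem norm_cesaroMean_sub_sq (ha : ∀ j, ⟪z j, z j⟫_ℝ = a)
    (hb : ∀ j k, j ≠ k → ⟪z j, z k⟫_ℝ = b) {N M : ℕ} (hN : N ≠ 0) (hNM : N ≤ M) :
    ‖cesaroMean z N - cesaroMean z M‖ ^ 2 = (a - b) * (1 / N - 1 / M) := by
  rw [norm_sub_sq_real, ← real_inner_self_eq_norm_sq, ← real_inner_self_eq_norm_sq,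
    inner_cesaroMean ha hb hN le_rfl, inner_cesaroMean ha hb hN hNM,
    inner_cesaroMean ha hb (by omega) le_rfl]
  ring

theorem norm_cesaroMean_four_pow_sub_le (ha : ∀ j, ⟪z j, z j⟫_ℝ = a)
    (hb : ∀ j k, j ≠ k → ⟪z j, z k⟫_ℝ = b) {K n m : ℕ} (hn : K ≤ n) (hm : K ≤ m) :
    ‖cesaroMean z (4 ^ n) - cesaroMean z (4 ^ m)‖ ≤ √(a - b) * (1 / 2) ^ K := by
  wlog hnm : n ≤ m generalizing n m
  · rw [norm_sub_rev]
    exact this hm hn (le_of_not_ge hnm)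
  have hab : 0 ≤ a - b := by
    have h := norm_cesaroMean_sub_sq ha hb one_ne_zero one_le_two
    norm_num at h
    nlinarith [sq_nonneg ‖cesaroMean z 1 - cesaroMean z 2‖]
  refine le_of_sq_le_sq ?_ (by positivity)
  calc ‖cesaroMean z (4 ^ n) - cesaroMean z (4 ^ m)‖ ^ 2
      = (a - b) * (1 / (4 ^ n : ℕ) - 1 / (4 ^ m : ℕ)) :=
        norm_cesaroMean_sub_sq ha hb (by positivity) (Nat.pow_le_pow_right (by norm_num) hnm)
    _ ≤ (a - b) * (1 / 4) ^ K := by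
        gcongr
        push_cast
        rw [← one_div_pow]
        exact (sub_le_self _ (by positivity)).trans
          (pow_le_pow_of_le_one (by norm_num) (by norm_num) hn)
    _ = (√(a - b) * (1 / 2) ^ K) ^ 2 := by
        rw [mul_pow, Real.sq_sqrt hab, ← pow_mul, mul_comm K, pow_mul]
        norm_num

end InnerProductSpace

section StrongLaw

variable {Ω : Type*} [MeasurableSpace Ω] {μ : Measure Ω}

theorem ae_exists_tendsto_cesaroMean_Lp {F : Type*} [NormedAddCommGroup F] [InnerProductSpace ℝ F]
    [CompleteSpace F] {f : ℕ → Lp F 2 μ} {a b : ℝ} (ha : ∀ j, ⟪f j, f j⟫_ℝ = a)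
    (hb : ∀ j k, j ≠ k → ⟪f j, f k⟫_ℝ = b) :
    ∀ᵐ x ∂μ, ∃ l, Tendsto (fun k => cesaroMean (fun j => f j x) (4 ^ k)) atTop (𝓝 l) := by
  have hcauchy : ∀ᵐ x ∂μ, ∃ l, Tendsto (fun k => cesaroMean f (4 ^ k) x) atTop (𝓝 l) := by
    refine Lp.ae_tendsto_of_cauchy_eLpNorm (p := 2)
      (B := fun K => ENNReal.ofReal ((√(a - b) + 1) * (1 / 2) ^ K))
      (fun k => Lp.aestronglyMeasurable _) one_le_two ?_ fun K n m hn hm => ?_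
    · exact (summable_geometric_two.mul_left _).tsum_ofReal_ne_top
    · rw [← eLpNorm_congr_ae (Lp.coeFn_sub _ _), ← Lp.enorm_def, ← ofReal_norm,
        ENNReal.ofReal_lt_ofReal_iff (by positivity)]
      refine (norm_cesaroMean_four_pow_sub_le ha hb hn hm).trans_lt ?_
      gcongr
      exact lt_add_one _
  have hmean : ∀ N, ∀ᵐ x ∂μ, cesaroMean f N x = cesaroMean (fun j => f j x) N := fun N => by
    filter_upwards [Lp.coeFn_smul (N : ℝ)⁻¹ (∑ j ∈ Finset.range N, f j),
      Lp.coeFn_finsetSum (Finset.range N) f] with x hsmul hsum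
    simp only [cesaroMean, hsmul, Pi.smul_apply, hsum, Finset.sum_apply]
  filter_upwards [hcauchy, ae_all_iff.2 hmean] with x ⟨l, hl⟩ hx
  exact ⟨l, by simpa only [hx] using hl⟩

theorem ae_exists_tendsto_cesaroMean_indicator [IsFiniteMeasure μ] {B : ℕ → Set Ω}
    (hB : ∀ j, MeasurableSet (B j)) {a b : ℝ} (ha : ∀ j, μ.real (B j) = a)
    (hb : ∀ j k, j ≠ k → μ.real (B j ∩ B k) = b) :
    ∀ᵐ x ∂μ, ∃ l : ℝ,
      Tendsto (fun k => cesaroMean (fun j => (B j).indicator 1 x) (4 ^ k)) atTop (𝓝 l) := by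
  set f : ℕ → Lp ℝ 2 μ := fun j => indicatorConstLp 2 (hB j) (measure_ne_top μ _) 1
  have hinner : ∀ j k, ⟪f j, f k⟫_ℝ = μ.real (B j ∩ B k) := fun j k =>
    L2.real_inner_indicatorConstLp_one_indicatorConstLp_one (hB j) (hB k)
  have hf : ∀ᵐ x ∂μ, ∀ j, f j x = (B j).indicator 1 x :=
    ae_all_iff.2 fun j => indicatorConstLp_coeFn
  filter_upwards [hf, ae_exists_tendsto_cesaroMean_Lp (f := f)
    (fun j => by rw [hinner, Set.inter_self, ha])
    (fun j k hjk => by rw [hinner, hb j k hjk])] with x hx ⟨l, hl⟩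
  exact ⟨l, by simpa only [hx] using hl⟩

end StrongLaw

theorem tsum_liminf_le_liminf_tsum {α ι : Type*} {l : Filter ι} [l.IsCountablyGenerated]
    (f : ι → α → ℝ≥0∞) :
    ∑' a, liminf (fun k => f k a) l ≤ liminf (fun k => ∑' a, f k a) l := by
  let _ : MeasurableSpace α := ⊤
  simpa only [lintegral_count] using
    lintegral_liminf_le (μ := Measure.count) (u := l) fun k => measurable_from_top (f := f k)

theorem lintegral_sum_indicator_div {Ω ι : Type*} [MeasurableSpace Ω] {μ : Measure Ω}
    {s : Finset ι} {B : ι → Set Ω} (hB : ∀ i ∈ s, MeasurableSet (B i)) (c : ℝ≥0∞) :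
    ∫⁻ x, (∑ i ∈ s, (B i).indicator 1 x) / c ∂μ = (∑ i ∈ s, μ (B i)) / c := by
  have hmeas : ∀ i ∈ s, Measurable ((B i).indicator (1 : Ω → ℝ≥0∞)) := fun i hi =>
    measurable_one.indicator (hB i hi)
  simp only [div_eq_mul_inv]
  rw [lintegral_mul_const _ (Finset.measurable_fun_sum s hmeas), lintegral_finsetSum' _
    fun i hi => (hmeas i hi).aemeasurable]
  exact congrArg (· * c⁻¹) (Finset.sum_congr rfl fun i hi => lintegral_indicator_one (hB i hi))

namespace EdgeNetwork

section Frequency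

/-- The proportion of the interaction `s` among the first `N` edges of the canonical
representative. -/
noncomputable def empirical (N : ℕ) (s : Interaction) (E : EdgeNetwork ℕ) : ℝ≥0∞ :=
  (∑ j ∈ Finset.range N, if E.rep j = s then 1 else 0) / N

/-- The asymptotic proportion of the interaction `s` in the canonical representative. The lower
limit makes it total, and powers of four make the proportions converge almost surely. -/
noncomputable def frequency (s : Interaction) (E : EdgeNetwork ℕ) : ℝ≥0∞ :=
  liminf (fun k => empirical (4 ^ k) s E) atTop

theorem measurable_empirical (N : ℕ) (s : Interaction) : Measurable (empirical N s) := by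
  refine (Finset.measurable_fun_sum _ fun j _ => ?_).div_const _
  exact .ite (measurable_rep j (measurableSet_singleton s)) measurable_const measurable_const

theorem measurable_frequency (s : Interaction) : Measurable (frequency s) :=
  Measurable.liminf fun _ => measurable_empirical _ _

theorem tsum_empirical {N : ℕ} (hN : N ≠ 0) (E : EdgeNetwork ℕ) : ∑' s, empirical N s E = 1 := by
  simp only [empirical, div_eq_mul_inv]
  rw [ENNReal.tsum_mul_right, Summable.tsum_finsetSum fun _ _ => ENNReal.summable]
  simp only [tsum_ite_eq', Finset.sum_const, Finset.card_range, nsmul_eq_mul, mul_one]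
  exact ENNReal.mul_inv_cancel (by exact_mod_cast hN) (ENNReal.natCast_ne_top N)

theorem tsum_frequency_le_one (E : EdgeNetwork ℕ) : ∑' s, frequency s E ≤ 1 := by
  refine (tsum_liminf_le_liminf_tsum _).trans_eq ?_
  simp only [fun k : ℕ => tsum_empirical (N := 4 ^ k) (by positivity) E, liminf_const]

theorem frequency_ne_top (s : Interaction) (E : EdgeNetwork ℕ) : frequency s E ≠ ∞ :=
  ne_top_of_le_ne_top ENNReal.one_ne_top ((ENNReal.le_tsum s).trans (tsum_frequency_le_one E))

theorem empirical_rep {N : ℕ} (hN : N ≠ 0) (i : ℕ) (E : EdgeNetwork ℕ) :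
    empirical N (E.rep i) E
      = ENNReal.ofReal (cesaroMean (fun j => {F | F.SameEdge j i}.indicator 1 E) N) := by
  have hpos : (0 : ℝ) < N := by positivity
  have hnonneg : ∀ j ∈ Finset.range N,
      0 ≤ {F : EdgeNetwork ℕ | F.SameEdge j i}.indicator (1 : EdgeNetwork ℕ → ℝ) E :=
    fun _ _ => Set.indicator_nonneg (fun _ _ => zero_le_one) E
  rw [cesaroMean, smul_eq_mul, inv_mul_eq_div, ENNReal.ofReal_div_of_pos hpos,
    ENNReal.ofReal_sum_of_nonneg hnonneg, ENNReal.ofReal_natCast, empirical]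
  congr! 2 with j
  simp only [Set.indicator_apply, Set.mem_ofPred_eq, sameEdge_iff_rep]
  split_ifs <;> simp

end Frequency

namespace ExchangeableLaw

variable {μ : Measure (EdgeNetwork ℕ)}

theorem measure_sameEdge (hμ : ExchangeableLaw μ) {i j : ℕ} (hij : i ≠ j) :
    μ {E | E.SameEdge j i} = μ {E | E.SameEdge 1 0} := by
  have hinj : Function.Injective ![i, j] := by
    simpa [Fin.cons_injective_iff, Function.injective_of_subsingleton] using hij
  have h := hμ.measure_preimage_reindex hinj {F | F.SameEdge 1 0}
  simp only [Set.preimage_ofPred_eq, restrict, sameEdge_reindex] at h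
  exact h

theorem measure_sameEdge_inter (hμ : ExchangeableLaw μ) {i j k : ℕ} (hij : i ≠ j) (hik : i ≠ k)
    (hjk : j ≠ k) :
    μ ({E | E.SameEdge j i} ∩ {E | E.SameEdge k i})
      = μ ({E | E.SameEdge 1 0} ∩ {E | E.SameEdge 2 0}) := by
  have hinj : Function.Injective ![i, j, k] := by
    intro a b h
    fin_cases a <;> fin_cases b <;> simp_all
  have h := hμ.measure_preimage_reindex hinj ({F | F.SameEdge 1 0} ∩ {F | F.SameEdge 2 0})
  simp only [Set.preimage_inter, Set.preimage_ofPred_eq, restrict, sameEdge_reindex] at h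
  exact h

theorem ae_exists_tendsto_cesaroMean_sameEdge [IsFiniteMeasure μ] (hμ : ExchangeableLaw μ)
    (i : ℕ) :
    ∀ᵐ E ∂μ, ∃ l : ℝ, Tendsto
      (fun k => cesaroMean (fun j => {F | F.SameEdge j i}.indicator 1 E) (4 ^ k)) atTop (𝓝 l) := by
  have hshift := ae_exists_tendsto_cesaroMean_indicator (μ := μ)
    (fun j => measurableSet_sameEdge (j + (i + 1)) i)
    (fun j => congrArg ENNReal.toReal (hμ.measure_sameEdge (by omega)))
    (fun j k hjk => congrArg ENNReal.toReal
      (hμ.measure_sameEdge_inter (by omega) (by omega) (by omega)))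
  filter_upwards [hshift] with E ⟨l, hl⟩
  refine ⟨l, tendsto_cesaroMean_of_shift (C := 1) (fun j => ?_)
    (tendsto_pow_atTop_atTop_of_one_lt (by norm_num)) hl⟩
  exact (norm_indicator_le_norm_self _ _).trans_eq norm_one

theorem ae_tendsto_empirical [IsFiniteMeasure μ] (hμ : ExchangeableLaw μ) :
    ∀ᵐ E ∂μ, ∀ s, Tendsto (fun k => empirical (4 ^ k) s E) atTop (𝓝 (frequency s E)) := by
  filter_upwards [ae_all_iff.2 hμ.ae_exists_tendsto_cesaroMean_sameEdge] with E hE s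
  suffices h : ∃ l, Tendsto (fun k => empirical (4 ^ k) s E) atTop (𝓝 l) by
    obtain ⟨l, hl⟩ := h
    rwa [frequency, hl.liminf_eq]
  by_cases hs : ∃ i, E.rep i = s
  · obtain ⟨i, rfl⟩ := hs
    obtain ⟨l, hl⟩ := hE i
    refine ⟨ENNReal.ofReal l, ?_⟩
    simp only [fun k : ℕ => empirical_rep (N := 4 ^ k) (by positivity) i E]
    exact ENNReal.tendsto_ofReal hl
  · push Not at hs
    exact ⟨0, by simp [empirical, hs]⟩

end ExchangeableLaw

section Total

variable {μ : Measure (EdgeNetwork ℕ)}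

theorem measurableSet_exists_sameEdge (m j : ℕ) :
    MeasurableSet {E : EdgeNetwork ℕ | ∃ i < m, E.SameEdge i j} :=
  measurableSet_setOfPred.2 <| .exists fun i =>
    measurable_const.and (measurableSet_setOfPred.1 (measurableSet_sameEdge i j))

theorem sum_image_rep_empirical (m N : ℕ) (E : EdgeNetwork ℕ) :
    ∑ s ∈ (Finset.range m).image E.rep, empirical N s E
      = (∑ j ∈ Finset.range N, {F | ∃ i < m, F.SameEdge i j}.indicator 1 E) / N := by
  simp only [empirical, div_eq_mul_inv]
  rw [← Finset.sum_mul, Finset.sum_comm]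
  simp [Set.indicator_apply, sameEdge_iff_rep, Finset.sum_ite_eq]

theorem ExchangeableLaw.measure_recurs_le_measure_exists_sameEdge [IsProbabilityMeasure μ]
    (hμ : ExchangeableLaw μ) (m j : ℕ) :
    μ {E | ∃ i < m, E.SameEdge (i + 1) 0} ≤ μ {E | ∃ i < m, E.SameEdge i j} := by
  rcases lt_or_ge j m with hj | hj
  · have huniv : {E : EdgeNetwork ℕ | ∃ i < m, E.SameEdge i j} = Set.univ :=
      Set.eq_univ_of_forall fun E => ⟨j, hj, sameEdge_iff_rep.2 rfl⟩
    exact prob_le_one.trans_eq (by rw [huniv, measure_univ])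
  · have hinj : Function.Injective (Fin.cons j Fin.val : Fin (m + 1) → ℕ) :=
      Fin.cons_injective_iff.2 ⟨by rintro ⟨i, rfl⟩; omega, Fin.val_injective⟩
    have h := hμ.measure_preimage_reindex hinj {F | ∃ i : Fin m, F.SameEdge i.succ 0}
    simp only [Set.preimage_ofPred_eq, restrict, sameEdge_reindex, Fin.cons_succ, Fin.cons_zero,
      Fin.val_succ, Fin.val_zero, Fin.exists_iff, exists_prop] at h
    exact h.ge

theorem ExchangeableLaw.measure_recurs_le_lintegral_sum_empirical [IsProbabilityMeasure μ]
    (hμ : ExchangeableLaw μ) (m : ℕ) {N : ℕ} (hN : N ≠ 0) :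
    μ {E | ∃ i < m, E.SameEdge (i + 1) 0}
      ≤ ∫⁻ E, ∑ s ∈ (Finset.range m).image E.rep, empirical N s E ∂μ := by
  simp only [sum_image_rep_empirical]
  rw [lintegral_sum_indicator_div fun j _ => measurableSet_exists_sameEdge m j,
    ENNReal.le_div_iff_mul_le (.inl (by exact_mod_cast hN)) (.inl (ENNReal.natCast_ne_top N)),
    mul_comm, ← nsmul_eq_mul]
  simpa using Finset.card_nsmul_le_sum (Finset.range N) _ _ fun j _ =>
    hμ.measure_recurs_le_measure_exists_sameEdge m j

theorem ExchangeableLaw.measure_recurs_le_lintegral_tsum_frequency [IsProbabilityMeasure μ]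
    (hμ : ExchangeableLaw μ) (m : ℕ) :
    μ {E | ∃ i < m, E.SameEdge (i + 1) 0} ≤ ∫⁻ E, ∑' s, frequency s E ∂μ := by
  have hlim : Tendsto
      (fun k : ℕ => ∫⁻ E, ∑ s ∈ (Finset.range m).image E.rep, empirical (4 ^ k) s E ∂μ) atTop
      (𝓝 (∫⁻ E, ∑ s ∈ (Finset.range m).image E.rep, frequency s E ∂μ)) := by
    refine tendsto_lintegral_of_dominated_convergence (fun _ => 1) (fun k => ?_) (fun k => ?_)
      (by simp) ?_
    · simp only [sum_image_rep_empirical]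
      exact (Finset.measurable_fun_sum _ fun j _ =>
        measurable_one.indicator (measurableSet_exists_sameEdge m j)).div_const _
    · exact .of_forall fun E => (ENNReal.sum_le_tsum _).trans_eq (tsum_empirical (by positivity) E)
    · filter_upwards [hμ.ae_tendsto_empirical] with E hE
      exact tendsto_finsetSum _ fun s _ => hE s
  exact (ge_of_tendsto' hlim fun k =>
    hμ.measure_recurs_le_lintegral_sum_empirical m (by positivity)).trans
    (lintegral_mono fun E => ENNReal.sum_le_tsum _)

theorem tendsto_measure_recurs [IsProbabilityMeasure μ] (hblip : ∀ᵐ E ∂μ, E.BlipFree) :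
    Tendsto (fun m => μ {E | ∃ i < m, E.SameEdge (i + 1) 0}) atTop (𝓝 1) := by
  have hmono : Monotone fun m : ℕ => {E : EdgeNetwork ℕ | ∃ i < m, E.SameEdge (i + 1) 0} :=
    fun _ _ hmm' _ ⟨i, hi, e⟩ => ⟨i, hi.trans_le hmm', e⟩
  have hunion : ∀ᵐ E ∂μ, E ∈ ⋃ m : ℕ, {E : EdgeNetwork ℕ | ∃ i < m, E.SameEdge (i + 1) 0} := by
    filter_upwards [hblip] with E hE
    obtain ⟨j, hj, e⟩ := blipFree_iff.1 hE 0
    obtain ⟨i, rfl⟩ := Nat.exists_eq_succ_of_ne_zero hj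
    exact Set.mem_iUnion.2 ⟨i + 1, i, i.lt_succ_self, e⟩
  rw [← measure_univ (μ := μ), ← measure_congr (eventuallyEq_univ.2 hunion)]
  exact tendsto_measure_iUnion_atTop hmono

theorem ExchangeableLaw.ae_tsum_frequency_eq_one [IsProbabilityMeasure μ] (hμ : ExchangeableLaw μ)
    (hblip : ∀ᵐ E ∂μ, E.BlipFree) : ∀ᵐ E ∂μ, ∑' s, frequency s E = 1 := by
  have hint : 1 ≤ ∫⁻ E, ∑' s, frequency s E ∂μ :=
    le_of_tendsto' (tendsto_measure_recurs hblip) hμ.measure_recurs_le_lintegral_tsum_frequency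
  have hfin : ∫⁻ E, ∑' s, frequency s E ∂μ ≠ ∞ := ne_top_of_le_ne_top ENNReal.one_ne_top
    ((lintegral_mono tsum_frequency_le_one).trans (by simp))
  exact ae_eq_of_ae_le_of_lintegral_le (.of_forall tsum_frequency_le_one) hfin
    aemeasurable_const (by simpa using hint)

end Total

end EdgeNetwork

section Sampling

theorem tendsto_descFactorial_div_pow (n : ℕ) :
    Tendsto (fun N : ℕ => (N.descFactorial n : ℝ≥0∞) / N ^ n) atTop (𝓝 1) := by
  have hne : ∀ᶠ N : ℕ in atTop, (N : ℝ) ^ n ≠ 0 :=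
    (eventually_ne_atTop 0).mono fun N hN => by positivity
  have h := ENNReal.tendsto_ofReal
    ((Asymptotics.isEquivalent_iff_tendsto_one hne).1 (isEquivalent_descFactorial n))
  rw [ENNReal.ofReal_one] at h
  refine h.congr' ((eventually_gt_atTop 0).mono fun N hN => ?_)
  rw [Pi.div_apply, ENNReal.ofReal_div_of_pos (by positivity), ENNReal.ofReal_natCast,
    ENNReal.ofReal_pow (Nat.cast_nonneg _), ENNReal.ofReal_natCast]

theorem card_not_injective_div_pow (n : ℕ) {N : ℕ} (hN : N ≠ 0) :
    (Fintype.card {g : Fin n → Fin N // ¬ Function.Injective g} : ℝ≥0∞) / N ^ n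
      = 1 - N.descFactorial n / N ^ n := by
  have hpow : (N : ℝ≥0∞) ^ n ≠ 0 := by positivity
  have hcard : Fintype.card {g : Fin n → Fin N // ¬ Function.Injective g}
      = N ^ n - N.descFactorial n := by
    rw [Fintype.card_subtype_compl, Fintype.card_congr
      (Equiv.subtypeInjectiveEquivEmbedding (Fin n) (Fin N)), Fintype.card_embedding_eq]
    simp
  rw [hcard, ENNReal.natCast_sub, ENNReal.sub_div fun _ _ => hpow, Nat.cast_pow,
    ENNReal.div_self hpow (ENNReal.pow_ne_top (ENNReal.natCast_ne_top N))]

theorem tsum_subtype_ite_eq {α : Type*} [DecidableEq α] (s : Set α) (x : α) :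
    ∑' t : s, (if x = t then 1 else 0 : ℝ≥0∞) = s.indicator 1 x := by
  rw [tsum_subtype s fun t => if x = t then (1 : ℝ≥0∞) else 0, tsum_eq_single x fun t ht => by
    simp [ht.symm]]
  by_cases hx : x ∈ s <;> simp [hx]

variable {n : ℕ}

/-- The total weight of the processes of `n` interactions inducing a network in `A`, each weighted
by the product of the weights `p` of its interactions. If `p` is a distribution, this is the
probability of `A` for the network induced by `n` i.i.d. interactions. -/
noncomputable def iidWeight (p : Interaction → ℝ≥0∞) (A : Set (EdgeNetwork (Fin n))) : ℝ≥0∞ :=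
  ∑' t : (network ⁻¹' A : Set (InteractionProcess (Fin n))), ∏ k, p (t.1 k)

theorem iidWeight_le_liminf {ι : Type*} {l : Filter ι} [l.NeBot] [l.IsCountablyGenerated]
    {q : ι → Interaction → ℝ≥0∞} {p : Interaction → ℝ≥0∞}
    (hq : ∀ s, Tendsto (fun k => q k s) l (𝓝 (p s))) (hp : ∀ s, p s ≠ ∞)
    (A : Set (EdgeNetwork (Fin n))) :
    iidWeight p A ≤ liminf (fun k => iidWeight (q k) A) l := by
  refine le_trans (ENNReal.tsum_le_tsum fun t => ?_) (tsum_liminf_le_liminf_tsum _)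
  exact (ENNReal.tendsto_finsetProd_of_ne_top _ (fun i _ => hq (t.1 i))
    fun i _ => hp _).liminf_eq.ge

namespace EdgeNetwork

theorem prod_empirical (N : ℕ) (t : InteractionProcess (Fin n)) (E : EdgeNetwork ℕ) :
    ∏ k, empirical N (t k) E
      = (∑ g : Fin n → Fin N, if (fun k => E.rep (g k)) = t then 1 else 0) / (N : ℝ≥0∞) ^ n := by
  simp only [empirical, div_eq_mul_inv, Finset.sum_range]
  rw [Finset.prod_mul_distrib, Finset.prod_univ_sum, Fintype.piFinset_univ]
  simp [Finset.prod_ite_zero, funext_iff, ENNReal.inv_pow]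

theorem iidWeight_empirical (N : ℕ) (A : Set (EdgeNetwork (Fin n))) (E : EdgeNetwork ℕ) :
    iidWeight (fun s => empirical N s E) A
      = (∑ g : Fin n → Fin N, (reindex (fun k => (g k : ℕ)) ⁻¹' A).indicator 1 E)
        / (N : ℝ≥0∞) ^ n := by
  simp only [iidWeight, prod_empirical, div_eq_mul_inv]
  rw [ENNReal.tsum_mul_right, Summable.tsum_finsetSum fun _ _ => ENNReal.summable]
  congr! 2 with g
  have hg : E.reindex (fun k => (g k : ℕ)) = network fun k => E.rep (g k) :=
    reindex_eq_network _ E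
  rw [tsum_subtype_ite_eq]
  refine Set.indicator_eq_indicator ?_ rfl
  rw [Set.mem_preimage, Set.mem_preimage, hg]

variable {μ : Measure (EdgeNetwork ℕ)} [IsProbabilityMeasure μ]

theorem ExchangeableLaw.sum_measure_preimage_reindex_le (hμ : ExchangeableLaw μ) (N : ℕ)
    (A : Set (EdgeNetwork (Fin n))) :
    ∑ g : Fin n → Fin N, μ (reindex (fun k => (g k : ℕ)) ⁻¹' A)
      ≤ N ^ n * μ (restrict n ⁻¹' A)
        + Fintype.card {g : Fin n → Fin N // ¬ Function.Injective g} := by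
  have hle : ∀ g : Fin n → Fin N, μ (reindex (fun k => (g k : ℕ)) ⁻¹' A)
      ≤ μ (restrict n ⁻¹' A) + if ¬ Function.Injective g then 1 else 0 := by
    intro g
    by_cases hg : Function.Injective g
    · exact (hμ.measure_preimage_reindex (Fin.val_injective.comp hg) A).trans_le le_self_add
    · rw [if_pos hg]
      exact prob_le_one.trans le_add_self
  refine (Finset.sum_le_sum fun g _ => hle g).trans_eq ?_
  rw [Finset.sum_add_distrib, Finset.sum_boole, ← Fintype.card_subtype]
  simp

theorem ExchangeableLaw.lintegral_iidWeight_empirical_le (hμ : ExchangeableLaw μ) {N : ℕ}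
    (hN : N ≠ 0) (A : Set (EdgeNetwork (Fin n))) :
    ∫⁻ E, iidWeight (fun s => empirical N s E) A ∂μ
      ≤ μ (restrict n ⁻¹' A) + (1 - N.descFactorial n / N ^ n) := by
  have hpow : (N : ℝ≥0∞) ^ n ≠ 0 := by positivity
  simp only [iidWeight_empirical]
  rw [lintegral_sum_indicator_div fun g _ => measurableSet_preimage_reindex _ A]
  refine (ENNReal.div_le_div_right (hμ.sum_measure_preimage_reindex_le N A) _).trans_eq ?_
  rw [ENNReal.add_div, card_not_injective_div_pow n hN,
    ENNReal.mul_div_right_comm,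
    ENNReal.div_self hpow (ENNReal.pow_ne_top (ENNReal.natCast_ne_top N)), one_mul]

theorem ExchangeableLaw.lintegral_iidWeight_frequency_le (hμ : ExchangeableLaw μ)
    (A : Set (EdgeNetwork (Fin n))) :
    ∫⁻ E, iidWeight (fun s => frequency s E) A ∂μ ≤ μ (restrict n ⁻¹' A) := by
  have hmeas : ∀ N, Measurable fun E => iidWeight (fun s => empirical N s E) A := fun N =>
    Measurable.tsum fun t => Finset.measurable_fun_prod _ fun k _ => measurable_empirical N _
  have hbound : Tendsto (fun k : ℕ => μ (restrict n ⁻¹' A)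
      + (1 - ((4 ^ k : ℕ).descFactorial n : ℝ≥0∞) / (4 ^ k : ℕ) ^ n)) atTop
      (𝓝 (μ (restrict n ⁻¹' A))) := by
    have h := (ENNReal.Tendsto.sub tendsto_const_nhds (tendsto_descFactorial_div_pow n)
      (.inl ENNReal.one_ne_top)).comp (tendsto_pow_atTop_atTop_of_one_lt (r := 4) (by norm_num))
    simpa using h.const_add (μ (restrict n ⁻¹' A))
  calc ∫⁻ E, iidWeight (fun s => frequency s E) A ∂μ
      ≤ ∫⁻ E, liminf (fun k => iidWeight (fun s => empirical (4 ^ k) s E) A) atTop ∂μ :=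
        lintegral_mono_ae <| hμ.ae_tendsto_empirical.mono fun E hE =>
          iidWeight_le_liminf hE (fun s => frequency_ne_top s E) A
    _ ≤ liminf (fun k => ∫⁻ E, iidWeight (fun s => empirical (4 ^ k) s E) A ∂μ) atTop :=
        lintegral_liminf_le fun k => hmeas (4 ^ k)
    _ ≤ _ := liminf_le_liminf (.of_forall fun k =>
        hμ.lintegral_iidWeight_empirical_le (by positivity) A)
    _ = μ (restrict n ⁻¹' A) := hbound.liminf_eq

end EdgeNetwork

end Sampling

section Identification

open EdgeNetwork

theorem eq_of_forall_measure_restrict_eq {μ ν : Measure (EdgeNetwork ℕ)} [IsFiniteMeasure μ]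
    (h : ∀ n (A : Set (EdgeNetwork (Fin n))), μ (restrict n ⁻¹' A) = ν (restrict n ⁻¹' A)) :
    μ = ν := by
  refine ext_of_generate_finite
    (⋃ n : ℕ, {B | MeasurableSet[MeasurableSpace.comap (restrict n) ⊤] B})
    (MeasurableSpace.generateFrom_iUnion_measurableSet _).symm
    (isPiSystem_iUnion_of_monotone _ (fun n => @MeasurableSpace.isPiSystem_measurableSet _
      (MeasurableSpace.comap (restrict n) ⊤)) ?_) ?_ (h 0 Set.univ)
  · rintro n m hnm _ ⟨A, -, rfl⟩
    refine ⟨reindex (Fin.castLE hnm) ⁻¹' A, trivial, ?_⟩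
    rw [← Set.preimage_comp]
    exact congrArg (· ⁻¹' A) (funext fun E => reindex_reindex Fin.val (Fin.castLE hnm) E)
  · rintro B hB
    obtain ⟨n, A, -, rfl⟩ := Set.mem_iUnion.1 hB
    exact h n A

theorem eq_of_forall_measure_restrict_le {μ ν : Measure (EdgeNetwork ℕ)} [IsProbabilityMeasure μ]
    [IsProbabilityMeasure ν]
    (h : ∀ n (A : Set (EdgeNetwork (Fin n))), μ (restrict n ⁻¹' A) ≤ ν (restrict n ⁻¹' A)) :
    μ = ν := by
  refine eq_of_forall_measure_restrict_eq fun n A => (h n A).antisymm ?_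
  have hA := measurableSet_preimage_restrict n A
  have hcompl := h n Aᶜ
  rw [Set.preimage_compl, prob_compl_eq_one_sub hA, prob_compl_eq_one_sub hA] at hcompl
  exact (ENNReal.sub_le_sub_iff_left prob_le_one ENNReal.one_ne_top).1 hcompl

namespace Simplex

instance (f : Simplex) : IsProbabilityMeasure f.iidLaw := by
  unfold iidLaw
  infer_instance

instance (f : Simplex) : IsProbabilityMeasure f.networkLaw :=
  Measure.isProbabilityMeasure_map measurable_network.aemeasurable

theorem iidLaw_preimage_singleton (f : Simplex) {n : ℕ} (t : InteractionProcess (Fin n)) :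
    f.iidLaw ((· ∘ Fin.val) ⁻¹' {t}) = ∏ k, f.toPMF (t k) := by
  set t' : InteractionProcess ℕ := Function.extend Fin.val t fun _ => []
  have ht' : ∀ k : Fin n, t' k = t k := Fin.val_injective.extend_apply _ _
  have hpi : (· ∘ Fin.val) ⁻¹' {t} = ((Finset.range n : Finset ℕ) : Set ℕ).pi fun i => {t' i} := by
    ext I
    simp [funext_iff, ← ht', Fin.forall_iff]
  rw [hpi, iidLaw, Measure.infinitePi_pi _ fun _ _ => MeasurableSet.of_discrete, Finset.prod_range]
  exact Finset.prod_congr rfl fun k _ => by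
    rw [ht', PMF.toMeasure_apply_singleton _ _ (measurableSet_singleton _)]

theorem networkLaw_restrict (f : Simplex) {n : ℕ} (A : Set (EdgeNetwork (Fin n))) :
    f.networkLaw (restrict n ⁻¹' A) = iidWeight f.toPMF A := by
  have hmeas : Measurable fun I : InteractionProcess ℕ => (I ∘ Fin.val : Fin n → Interaction) := by
    fun_prop
  rw [networkLaw, Measure.map_apply measurable_network (measurableSet_preimage_restrict n A)]
  change f.iidLaw ((· ∘ Fin.val) ⁻¹' (network ⁻¹' A)) = _
  rw [← tsum_measure_preimage_singleton (Set.to_countable _)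
    fun t _ => hmeas (measurableSet_singleton t)]
  exact tsum_congr fun t => f.iidLaw_preimage_singleton t.1

open Classical in
/-- The point of the simplex with coordinates `p` if they sum to one. The point mass at the empty
interaction is a junk value for all other `p`. -/
noncomputable def ofWeights (p : Interaction → ℝ≥0∞) : Simplex :=
  ⟨if ∑' s, p s = 1 then fun s => (p s).toReal else Pi.single [] 1, by
    split_ifs with h
    · have htop : ∑' s, p s ≠ ∞ := h ▸ ENNReal.one_ne_top
      refine ⟨fun _ => ENNReal.toReal_nonneg, ?_⟩
      rw [← ENNReal.toReal_one, ← h, ENNReal.tsum_toReal_eq (ENNReal.ne_top_of_tsum_ne_top htop)]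
      exact (ENNReal.summable_toReal htop).hasSum
    · have hnonneg : (0 : Interaction → ℝ) ≤ Pi.single [] 1 := Pi.single_nonneg.2 zero_le_one
      exact ⟨hnonneg, hasSum_pi_single [] 1⟩⟩

theorem toPMF_ofWeights {p : Interaction → ℝ≥0∞} (h : ∑' s, p s = 1) :
    ⇑(ofWeights p).toPMF = p := by
  funext s
  change ENNReal.ofReal ((ofWeights p).1 s) = p s
  simp only [ofWeights, if_pos h]
  exact ENNReal.ofReal_toReal (ENNReal.ne_top_of_tsum_ne_top (h ▸ ENNReal.one_ne_top) s)

theorem measurable_ofWeights : Measurable ofWeights :=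
  Measurable.subtype_mk <| .ite (Measurable.tsum measurable_pi_apply (measurableSet_singleton 1))
    (measurable_pi_iff.2 fun s => (measurable_pi_apply s).ennreal_toReal) measurable_const

end Simplex

instance (φ : Measure Simplex) [IsProbabilityMeasure φ] : IsProbabilityMeasure (mixtureLaw φ) :=
  isProbabilityMeasure_bind Simplex.measurable_networkLaw.aemeasurable
    (.of_forall fun _ => inferInstance)

namespace EdgeNetwork

/-- The asymptotic proportions of all interactions in the canonical representative, which is where
the mixing measure lives. Meaningful when they sum to one. -/
noncomputable def frequencies (E : EdgeNetwork ℕ) : Simplex :=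
  .ofWeights fun s => frequency s E

theorem measurable_frequencies : Measurable frequencies :=
  Simplex.measurable_ofWeights.comp (measurable_pi_iff.2 measurable_frequency)

theorem networkLaw_frequencies_restrict {E : EdgeNetwork ℕ} (h : ∑' s, frequency s E = 1) {n : ℕ}
    (A : Set (EdgeNetwork (Fin n))) :
    E.frequencies.networkLaw (restrict n ⁻¹' A) = iidWeight (fun s => frequency s E) A := by
  rw [Simplex.networkLaw_restrict, frequencies, Simplex.toPMF_ofWeights h]

theorem ExchangeableLaw.mixtureLaw_frequencies {μ : Measure (EdgeNetwork ℕ)}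
    [IsProbabilityMeasure μ] (hμ : ExchangeableLaw μ) (hblip : ∀ᵐ E ∂μ, E.BlipFree) :
    mixtureLaw (μ.map frequencies) = μ := by
  have : IsProbabilityMeasure (μ.map frequencies) :=
    Measure.isProbabilityMeasure_map measurable_frequencies.aemeasurable
  refine eq_of_forall_measure_restrict_le fun n A => ?_
  have hA := measurableSet_preimage_restrict n A
  calc mixtureLaw (μ.map frequencies) (restrict n ⁻¹' A)
      = ∫⁻ E, E.frequencies.networkLaw (restrict n ⁻¹' A) ∂μ := by
        rw [mixtureLaw_apply _ hA]
        exact lintegral_map ((Measure.measurable_coe hA).comp Simplex.measurable_networkLaw)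
          measurable_frequencies
    _ = ∫⁻ E, iidWeight (fun s => frequency s E) A ∂μ :=
        lintegral_congr_ae <| (hμ.ae_tsum_frequency_eq_one hblip).mono fun E hE =>
          networkLaw_frequencies_restrict hE A
    _ ≤ μ (restrict n ⁻¹' A) := hμ.lintegral_iidWeight_frequency_le A

end EdgeNetwork

end Identification

end EdgeExch

theorem theorem4p2 {Ω : Type*} [MeasurableSpace Ω] (P : Measure Ω) [IsProbabilityMeasure P]
    (Y : Ω → EdgeExch.EdgeNetwork ℕ) (hY : Measurable Y)
    (hexch : EdgeExch.EdgeExchangeable P Y)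
    (hblip : ∀ᵐ ω ∂P, (Y ω).BlipFree) :
    ∃ φ : Measure EdgeExch.Simplex, IsProbabilityMeasure φ ∧
      P.map Y = EdgeExch.mixtureLaw φ := by
  have : IsProbabilityMeasure (P.map Y) := Measure.isProbabilityMeasure_map hY.aemeasurable
  have hlaw := EdgeExch.EdgeNetwork.exchangeableLaw_map hY hexch
  have hlawblip := (ae_map_iff hY.aemeasurable EdgeExch.EdgeNetwork.measurableSet_blipFree).2 hblip
  exact ⟨(P.map Y).map EdgeExch.EdgeNetwork.frequencies,
    Measure.isProbabilityMeasure_map EdgeExch.EdgeNetwork.measurable_frequencies.aemeasurable,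
    (hlaw.mixtureLaw_frequencies hlawblip).symm⟩
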